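/- Let $\rho=\frac{\sqrt5-1}{2}$, let $q_0=(\frac12,\frac{\sqrt3}{2})$, $q_1=(0,0)$, $q_2=(1,0)$ in $\mathbb R^2$, and let $$F_0(x)=\rho^2(x-q_0)+q_0,\qquad F_1(x)=\rho(x-q_1)+q_1,\qquad F_2(x)=\rho(x-q_2)+q_2 .$$ For a finite word $w=w_1\cdots w_m$ in the letters $0,1,2$ put $|w|=m$ and $F_w=F_{w_1}\circ\cdots\circ F_{w_m}$. Let $W_1\subset\bigcup_{n\ge 0}\{1,2\}^n\times\{0\}$ be a set of words that contains, for every map $F_w$ with $w\in\bigcup_{n\ge0}\{1,2\}^n\times\{0\}$, exactly one word $w'$ with $F_{w'}=F_w$. Put $V_0=\{q_0,q_1,q_2\}$, $V_1=\bigcup_{w\in W_1}F_wV_0$, and let $\bar V_1$ be the closure of $V_1$ in $\mathbb R^2$ (it contains $V_0$). Let $\mathcal M$ be the set of all resistance forms on $V_0$, that is, of all forms $$\mathcal D(f,g)=\tfrac12\sum_{i,j=0}^{2}a_{i,j}\big(f(q_i)-f(q_j)\big)\big(g(q_i)-g(q_j)\big),\qquad f,g:V_0\to\mathbb R,$$ with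 $(a_{i,j})$ a symmetric, entrywise nonnegative, irreducible $3\times3$ matrix with zero diagonal, and let $\mathcal M_S\subset\mathcal M$ be the set of those with $a_{0,1}=a_{0,2}$. Write $\mathcal D(f)=\mathcal D(f,f)$. For $\rho<r<1$ and $\mathcal D\in\mathcal M$ let $$\Psi_r\mathcal D(f)=\sum_{w\in W_1}r^{-|w|+1}\,\mathcal D\big((f\circ F_w)|_{V_0}\big)\in[0,\infty],\qquad f\in C(\bar V_1),$$ and let $\mathcal R_r\mathcal D$ be the trace of $\Psi_r\mathcal D$ on $V_0$, $$\mathcal R_r\mathcal D(u)=\inf\{\Psi_r\mathcal D(f): f\in C(\bar V_1),\ \Psi_r\mathcal D(f)<\infty,\ f|_{V_0}=u\},\qquad u:V_0\to\mathbb R .$$ **Theorem.** Let $\rho<r<1$, and let $\mathcal D\in\mathcal M_S$ satisfy $\mathcal R_r\mathcal D=\lambda\mathcal D$ for some $\lambda>0$. Then $\mathcal D$ is, up to positive constant multiples, the unique solution of this equation in all of $\mathcal M$: for every $\mathcal D'\in\mathcal M$, there is a $\lambda'>0$ with $\mathcal R_r\mathcal D'=\lambda'\mathcal D'$ if and only if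 $\mathcal D'=c\,\mathcal D$ for some $c>0$. -/

import Mathlib

noncomputable section

namespace GoldenGasket

/-- The golden ratio `ρ = (√5 - 1) / 2`. -/
def rho : ℝ := (Real.sqrt 5 - 1) / 2

/-- The Euclidean plane. -/
abbrev Plane : Type := EuclideanSpace ℝ (Fin 2)

/-- The vertices `q₀, q₁, q₂` of the equilateral triangle; `V₀ = {q₀, q₁, q₂}`. -/
def q : Fin 3 → Plane := ![!₂[1 / 2, Real.sqrt 3 / 2], !₂[0, 0], !₂[1, 0]]

/-- The contraction ratios `ρ², ρ, ρ` of `F₀, F₁, F₂`. -/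
def ratio : Fin 3 → ℝ := ![rho ^ 2, rho, rho]

/-- The similitudes `F_i (x) = ρ_i (x - q_i) + q_i`. -/
def F (i : Fin 3) (x : Plane) : Plane := ratio i • (x - q i) + q i

/-- `F_w = F_{w₁} ∘ ⋯ ∘ F_{w_m}` for a word `w = w₁ ⋯ w_m`; the empty word gives the identity. -/
def Fword (w : List (Fin 3)) : Plane → Plane := w.foldr (fun i g => F i ∘ g) id

/-- The words `v0` with `v` a (possibly empty) word in the letters `1, 2`. -/
def topWords : Set (List (Fin 3)) := {w | ∃ v : List (Fin 3), (0 : Fin 3) ∉ v ∧ w = v ++ [0]}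

/-- `W` is an admissible choice of the word set `W₁`: among the words `v0` with `v` a word in
`1, 2`, it contains exactly one word for each of the maps `F_w`. -/
structure IsWordSelection (W : Set (List (Fin 3))) : Prop where
  subset : W ⊆ topWords
  exists_eq : ∀ w ∈ topWords, ∃ w' ∈ W, Fword w = Fword w'
  injOn : Set.InjOn Fword W

/-- The vertex set `V₁ = ⋃_{w ∈ W₁} F_w V₀` of the infinite graph. -/
def V1 (W : Set (List (Fin 3))) : Set Plane := ⋃ w ∈ W, Fword w '' Set.range q

/-- The form `(f, g) ↦ ½ ∑_{i,j} a_{ij} (f(q_i) - f(q_j)) (g(q_i) - g(q_j))` on functions on `V₀`.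
A function on `V₀` is written as the function `i ↦ f(q_i)` of the index. -/
def conductanceForm (a : Matrix (Fin 3) (Fin 3) ℝ) : LinearMap.BilinForm ℝ (Fin 3 → ℝ) :=
  LinearMap.mk₂ ℝ
    (fun f g => 1 / 2 * ∑ i, ∑ j, a i j * (f i - f j) * (g i - g j))
    (fun f f' g => by simp only [Pi.add_apply, Fin.sum_univ_three]; ring)
    (fun c f g => by simp only [Pi.smul_apply, smul_eq_mul, Fin.sum_univ_three]; ring)
    (fun f g g' => by simp only [Pi.add_apply, Fin.sum_univ_three]; ring)
    (fun c f g => by simp only [Pi.smul_apply, smul_eq_mul, Fin.sum_univ_three]; ring)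

/-- `a` is a conductance matrix on `V₀`: symmetric, zero on the diagonal, entrywise nonnegative
and irreducible (the last two are `Matrix.IsIrreducible`). -/
structure IsConductance (a : Matrix (Fin 3) (Fin 3) ℝ) : Prop where
  symm : a.IsSymm
  diag : ∀ i, a i i = 0
  irreducible : a.IsIrreducible

/-- `𝓜`: the (non-degenerate) resistance forms on the finite set `V₀`. -/
def M : Set (LinearMap.BilinForm ℝ (Fin 3 → ℝ)) :=
  {D | ∃ a, IsConductance a ∧ D = conductanceForm a}

/-- `𝓜_S`: the symmetric resistance forms on `V₀`, that is, those with `a₀₁ = a₀₂`. -/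
def MS : Set (LinearMap.BilinForm ℝ (Fin 3 → ℝ)) :=
  {D | ∃ a, IsConductance a ∧ a 0 1 = a 0 2 ∧ D = conductanceForm a}

/-- The restriction `f ∘ F_w` to `V₀`. -/
def pullback (w : List (Fin 3)) (f : Plane → ℝ) : Fin 3 → ℝ := fun i => f (Fword w (q i))

/-- The energy `Ψ_r D (f) = ∑_{w ∈ W₁} r^{-|w|+1} D(f ∘ F_w)` with values in `[0, ∞]`. It depends
only on the values of `f` on `V₁`. -/
def Psi (W : Set (List (Fin 3))) (r : ℝ) (D : LinearMap.BilinForm ℝ (Fin 3 → ℝ))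
    (f : Plane → ℝ) : ENNReal :=
  ∑' w : W, ENNReal.ofReal
    (r ^ (-((w : List (Fin 3)).length : ℤ) + 1) * D (pullback w f) (pullback w f))

/-- The domain of `Ψ_r D` as a form on the closure of `V₁`: the functions continuous on this
closure which have finite energy (the values elsewhere in the plane play no role). -/
def DomPsi (W : Set (List (Fin 3))) (r : ℝ) (D : LinearMap.BilinForm ℝ (Fin 3 → ℝ)) :
    Set (Plane → ℝ) :=
  {f | ContinuousOn f (closure (V1 W)) ∧ Psi W r D f < ⊤}

/-- The renormalization map: `R_r D` is the trace of `Ψ_r D` on `V₀`, whose energy at `u` is the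
infimum of `Ψ_r D (f)` over the `f` in the domain with `f = u` on `V₀`
(and `∞` if there is no such `f`). -/
def renorm (W : Set (List (Fin 3))) (r : ℝ) (D : LinearMap.BilinForm ℝ (Fin 3 → ℝ))
    (u : Fin 3 → ℝ) : ENNReal :=
  ⨅ f ∈ {f | f ∈ DomPsi W r D ∧ ∀ i, f (q i) = u i}, Psi W r D f

/-- `R_r D = lam D`, as an identity of quadratic forms on functions on `V₀`. -/
def SolvesRenorm (W : Set (List (Fin 3))) (r lam : ℝ)
    (D : LinearMap.BilinForm ℝ (Fin 3 → ℝ)) : Prop :=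
  ∀ u : Fin 3 → ℝ, renorm W r D u = ENNReal.ofReal (lam * D u u)

end GoldenGasket

end

noncomputable section
namespace GoldenGasket

open Filter Topology

/-! ### Coordinates of the vertices and cells -/

/-! Given a second solution `D'`, let `α` be the minimum of `D'/D`, attained at `f`, and `β` the
minimum of `D/D'`, attained at `g`. Near-minimizers of one energy are competitors for the other, so
the two touchings force equal eigenvalues (`SolvesRenorm.eigenvalue_le`). Suppose `D' ≠ α D`. A
minimizing sequence for `D'` with boundary values `f` is then minimizing for `D` too, and on each
cell the gap `D' - α D` tends to zero (`exists_common_minimizing`). This gap is a nonzero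
semidefinite form whose null vectors, modulo constants, are the multiples of `f`
(`exists_deviation_form`). In the limit every cell therefore carries a scaled copy of `f` plus a
constant.

One scalar per cell, its slope, now describes the limiting increments. Kirchhoff's law for the
symmetric form passes slopes from a cell to those below (`Setup.tendsto_slope`). The graph has
cycles, because `ρ + ρ² = 1`, and increments along two routes to one vertex must agree. Unless `f`
is antisymmetric, meaning `(f 1 - f 0) + (f 2 - f 0) = 0`, two such cycles are incompatible: the
first forces equal increments on the two sides of a cell, the second excludes them
(`inconsistent_increments`).

The same applies to `g` when `D ≠ β D'`. Antisymmetric functions modulo constants form a line, so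
`f` and `g` see the same ratio, `α β = 1`, and the two inequalities close up to `D' = α D`.

Infima need not be attained, so all of this is done along minimizing sequences. -/

lemma rho_sq : rho ^ 2 = 1 - rho := by
  have h : Real.sqrt 5 ^ 2 = 5 := Real.sq_sqrt (by norm_num)
  unfold rho
  linear_combination h / 4

lemma rho_gt : (0.6 : ℝ) < rho := by
  have : (2.2 : ℝ) < Real.sqrt 5 := Real.lt_sqrt_of_sq_lt (by norm_num)
  unfold rho; linarith

lemma rho_lt : rho < (0.62 : ℝ) := by
  have : Real.sqrt 5 < (2.24 : ℝ) := (Real.sqrt_lt' (by norm_num)).2 (by norm_num)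
  unfold rho; linarith

lemma rho_pos : 0 < rho := by linarith [rho_gt]

lemma rho_lt_one : rho < 1 := by linarith [rho_lt]

/-- The vertex of height `ρⁿ` (relative to `q₀`) and horizontal position `t`. -/
def pt (n : ℕ) (t : ℝ) : Plane := rho ^ n • q 0 + (rho ^ 2 * t) • q 2

lemma q_zero_zero : q 0 0 = 1 / 2 := by simp [q]
lemma q_zero_one : q 0 1 = Real.sqrt 3 / 2 := by simp [q]
lemma q_one : q 1 = 0 := by ext i; fin_cases i <;> simp [q]
lemma q_two_zero : q 2 0 = 1 := by simp [q]
lemma q_two_one : q 2 1 = 0 := by simp [q]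

lemma pt_zero (n : ℕ) (t : ℝ) : pt n t 0 = rho ^ n / 2 + rho ^ 2 * t := by
  simp [pt, q_zero_zero, q_two_zero]; ring

lemma pt_one (n : ℕ) (t : ℝ) : pt n t 1 = rho ^ n * (Real.sqrt 3 / 2) := by
  simp [pt, q_zero_one, q_two_one]

lemma sqrt_three_half_pos : 0 < Real.sqrt 3 / 2 := by positivity

lemma pt_inj {n m : ℕ} {t s : ℝ} : pt n t = pt m s ↔ n = m ∧ t = s := by
  refine ⟨fun h => ?_, by rintro ⟨rfl, rfl⟩; rfl⟩
  have h1 : pt n t 1 = pt m s 1 := by rw [h]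
  rw [pt_one, pt_one] at h1
  have hnm : n = m :=
    pow_right_injective₀ rho_pos rho_lt_one.ne (mul_right_cancel₀ sqrt_three_half_pos.ne' h1)
  subst hnm
  have h0 : pt n t 0 = pt n s 0 := by rw [h]
  rw [pt_zero, pt_zero] at h0
  exact ⟨rfl, mul_left_cancel₀ (pow_pos rho_pos 2).ne' (add_left_cancel h0)⟩

lemma pt_zero_zero : pt 0 0 = q 0 := by simp [pt]

lemma pt_ne_q_one (n : ℕ) (t : ℝ) : q 1 ≠ pt n t := fun h => by
  have h1 : q 1 1 = pt n t 1 := by rw [h]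
  rw [pt_one, q_one] at h1
  exact (mul_pos (pow_pos rho_pos n) sqrt_three_half_pos).ne h1

lemma pt_ne_q_two (n : ℕ) (t : ℝ) : q 2 ≠ pt n t := fun h => by
  have h1 : q 2 1 = pt n t 1 := by rw [h]
  rw [pt_one, q_two_one] at h1
  exact (mul_pos (pow_pos rho_pos n) sqrt_three_half_pos).ne h1

/-- The horizontal position of the cell of a word. -/
def pos : List (Fin 3) → ℝ
  | [] => 0
  | i :: v => (if i = 2 then 1 else 0) + rho * pos v

lemma F_one (x : Plane) : F 1 x = rho • x := by simp [F, ratio, q_one]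

lemma F_two (x : Plane) : F 2 x = rho • x + rho ^ 2 • q 2 := by
  have : F 2 x = rho • x + (1 - rho) • q 2 := by simp only [F, ratio]; simp; module
  rw [this, rho_sq]

lemma F_zero (x : Plane) : F 0 x = rho • q 0 + rho ^ 2 • x := by
  have : F 0 x = (1 - rho ^ 2) • q 0 + rho ^ 2 • x := by simp only [F, ratio]; simp; module
  rw [this, rho_sq]; simp

/-- The map depends on the word only through its length and its position, so the pair of these two
numbers encodes the cell. -/
lemma Fword_append_zero {v : List (Fin 3)} (hv : (0 : Fin 3) ∉ v) (x : Plane) :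
    Fword (v ++ [0]) x = rho ^ v.length • (rho • q 0 + rho ^ 2 • x) + (rho ^ 2 * pos v) • q 2 := by
  induction v with
  | nil => simp [Fword, F_zero, pos]
  | cons i v ih =>
    have hi : i ≠ 0 := fun h => hv (by simp [h])
    have hv' : (0 : Fin 3) ∉ v := fun h => hv (by simp [h])
    have hs : Fword (i :: v ++ [0]) x = F i (Fword (v ++ [0]) x) := rfl
    rw [hs, ih hv']
    have : i = 1 ∨ i = 2 := by omega
    rcases this with rfl | rfl
    · simp only [F_one, List.length_cons, pos]; simp; module
    · simp only [F_two, List.length_cons, pos]; simp; module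

lemma pos_append_zero (v : List (Fin 3)) : pos (v ++ [0]) = pos v := by
  induction v with
  | nil => simp [pos]
  | cons i v ih => simp [pos, ih]

lemma Fword_top {w : List (Fin 3)} (hw : w ∈ topWords) {n : ℕ} (hn : w.length = n + 1)
    (x : Plane) :
    Fword w x = rho ^ n • (rho • q 0 + rho ^ 2 • x) + (rho ^ 2 * pos w) • q 2 := by
  obtain ⟨v, hv, rfl⟩ := hw
  obtain rfl : v.length = n := by simpa using hn
  rw [Fword_append_zero hv, pos_append_zero]

lemma exists_length {w : List (Fin 3)} (hw : w ∈ topWords) : ∃ n, w.length = n + 1 := by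
  obtain ⟨v, hv, rfl⟩ := hw
  exact ⟨v.length, by simp⟩

lemma Fword_q_zero {w : List (Fin 3)} (hw : w ∈ topWords) {n : ℕ} (hn : w.length = n + 1) :
    Fword w (q 0) = pt n (pos w) := by
  rw [Fword_top hw hn, ← add_smul, rho_sq]; simp [pt, rho_sq]

lemma Fword_q_one {w : List (Fin 3)} (hw : w ∈ topWords) {n : ℕ} (hn : w.length = n + 1) :
    Fword w (q 1) = pt (n + 1) (pos w) := by
  rw [Fword_top hw hn, q_one, pt]; simp only [smul_zero, add_zero, smul_smul, pow_succ]

lemma Fword_q_two {w : List (Fin 3)} (hw : w ∈ topWords) {n : ℕ} (hn : w.length = n + 1) :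
    Fword w (q 2) = pt (n + 1) (pos w + rho ^ n) := by
  rw [Fword_top hw hn, pt, pow_succ]; module

/-- Two selected words with the same length and position are equal. -/
lemma IsWordSelection.eq_of_pos {W : Set (List (Fin 3))} (hW : IsWordSelection W)
    {w w' : List (Fin 3)} (hw : w ∈ W) (hw' : w' ∈ W) (hl : w.length = w'.length)
    (hp : pos w = pos w') : w = w' := by
  obtain ⟨n, hn⟩ := exists_length (hW.subset hw)
  refine hW.injOn hw hw' (funext fun x => ?_)
  rw [Fword_top (hW.subset hw) hn, Fword_top (hW.subset hw') (hl ▸ hn), hp]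

/-- The selection may contain a different word for the same map; length and position are what
survives. -/
lemma IsWordSelection.exists_word {W : Set (List (Fin 3))} (hW : IsWordSelection W)
    (v : List (Fin 3)) (hv : (0 : Fin 3) ∉ v) :
    ∃ w ∈ W, w.length = v.length + 1 ∧ pos w = pos v := by
  have ht : v ++ [0] ∈ topWords := ⟨v, hv, rfl⟩
  obtain ⟨w, hw, h⟩ := hW.exists_eq _ ht
  obtain ⟨n, hn⟩ := exists_length (hW.subset hw)
  have h0 : Fword (v ++ [0]) (q 0) = Fword w (q 0) := by rw [h]
  rw [Fword_q_zero ht (by simp : _ = v.length + 1), Fword_q_zero (hW.subset hw) hn, pt_inj,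
    pos_append_zero] at h0
  exact ⟨w, hw, by omega, h0.2.symm⟩

/-! ### Vertices are isolated -/

/-- The vertices of a cell of word length `m + 1` lie at levels `m` and `m + 1`, so only finitely
many words reach strictly above level `n + 1`: vertices accumulate only on the bottom line. -/
lemma V1_subset {W : Set (List (Fin 3))} (hW : W ⊆ topWords) (n : ℕ) :
    V1 W ∩ {x | rho ^ (n + 1) * (Real.sqrt 3 / 2) < x 1} ⊆
      ⋃ w ∈ {w : List (Fin 3) | w.length ≤ n + 1}, Fword w '' Set.range q := by
  rintro x ⟨hx, hxn⟩
  simp only [V1, Set.mem_iUnion] at hx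
  obtain ⟨w, hw, hx⟩ := hx
  simp only [Set.mem_iUnion]
  refine ⟨w, ?_, hx⟩
  obtain ⟨_, ⟨i, rfl⟩, rfl⟩ := hx
  obtain ⟨m, hm⟩ := exists_length (hW hw)
  have hlt : ∀ k t, m ≤ k → rho ^ (n + 1) * (Real.sqrt 3 / 2) < pt k t 1 → m ≤ n := by
    intro k t hk h
    rw [pt_one] at h
    have h1 := lt_of_mul_lt_mul_right h sqrt_three_half_pos.le
    have h2 := (pow_lt_pow_iff_right_of_lt_one₀ rho_pos rho_lt_one).1 h1
    omega
  have : m ≤ n := by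
    simp only [Set.mem_ofPred_eq] at hxn
    fin_cases i
    · exact hlt m _ le_rfl (Fword_q_zero (hW hw) hm ▸ hxn)
    · exact hlt (m + 1) _ (by omega) (Fword_q_one (hW hw) hm ▸ hxn)
    · exact hlt (m + 1) _ (by omega) (Fword_q_two (hW hw) hm ▸ hxn)
  simp only [Set.mem_ofPred_eq]; omega

lemma finite_length_le (n : ℕ) : {w : List (Fin 3) | w.length ≤ n}.Finite :=
  List.finite_length_le (Fin 3) n

/-- The indicator function of a single point of the plane. -/
def bump (P : Plane) : Plane → ℝ := Set.indicator {P} 1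

lemma continuousOn_bump {W : Set (List (Fin 3))} (hW : W ⊆ topWords) (n : ℕ) (t : ℝ) :
    ContinuousOn (bump (pt n t)) (closure (V1 W)) := by
  set P := pt n t with hP
  set T := ⋃ w ∈ {w : List (Fin 3) | w.length ≤ n + 1}, Fword w '' Set.range q with hT
  have hTfin : T.Finite := (finite_length_le (n + 1)).biUnion
    fun w _ => (Set.finite_range q).image _
  set U : Set Plane := {x | rho ^ (n + 1) * (Real.sqrt 3 / 2) < x 1} with hU
  have hUo : IsOpen U := isOpen_lt continuous_const (by fun_prop)
  have hPU : P ∈ U := by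
    simp only [hU, Set.mem_ofPred_eq, hP, pt_one]
    exact mul_lt_mul_of_pos_right
      (pow_lt_pow_right_of_lt_one₀ rho_pos rho_lt_one (by omega)) sqrt_three_half_pos
  -- Above level `n + 1` taking the closure adds nothing, since a finite set is closed; hence `P` is
  -- isolated in the closure.
  have hsub : closure (V1 W) ∩ U ⊆ T := by
    rintro x ⟨hx, hxU⟩
    have h1 : x ∈ closure (V1 W ∩ U) := by
      rw [Set.inter_comm]; exact hUo.inter_closure ⟨hxU, hx⟩
    exact (closure_minimal (V1_subset hW n) hTfin.isClosed) h1
  intro x _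
  by_cases hx : x = P
  · subst hx
    have hO : U ∩ (T \ {P})ᶜ ∈ nhds P :=
      (hUo.inter (hTfin.subset Set.sdiff_subset).isClosed.isOpen_compl).mem_nhds
        ⟨hPU, fun h => h.2 rfl⟩
    refine (continuousWithinAt_const (b := (1 : ℝ))).congr_of_eventuallyEq ?_
      (by simp [bump])
    filter_upwards [mem_nhdsWithin_of_mem_nhds hO, self_mem_nhdsWithin] with y hy hyS
    have : y = P := by
      by_contra hne
      exact hy.2 ⟨hsub ⟨hyS, hy.1⟩, hne⟩
    simp [bump, this]
  · refine (continuousWithinAt_const (b := (0 : ℝ))).congr_of_eventuallyEq ?_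
      (by simp [bump, hx])
    filter_upwards [mem_nhdsWithin_of_mem_nhds (isOpen_ne.mem_nhds hx)] with y hy
    simp [bump, hy]


/-! ### Energies of cells and minimizing sequences -/

/-- The contribution of the cell `w` to the mutual energy of `g` and `h`. -/
def cellForm (r : ℝ) (D : LinearMap.BilinForm ℝ (Fin 3 → ℝ)) (w : List (Fin 3))
    (g h : Plane → ℝ) : ℝ :=
  r ^ (-(w.length : ℤ) + 1) * D (pullback w g) (pullback w h)

section
variable {W : Set (List (Fin 3))} {r lam : ℝ} {D : LinearMap.BilinForm ℝ (Fin 3 → ℝ)}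

lemma cellForm_nonneg (hr : 0 < r) (hD : ∀ u, 0 ≤ D u u) (w : List (Fin 3)) (h : Plane → ℝ) :
    0 ≤ cellForm r D w h h := mul_nonneg (zpow_pos hr _).le (hD _)

lemma Psi_eq (hr : 0 < r) (hD : ∀ u, 0 ≤ D u u) {h : Plane → ℝ}
    (hs : Summable fun w : W => cellForm r D w h h) :
    Psi W r D h = ENNReal.ofReal (∑' w : W, cellForm r D w h h) :=
  (ENNReal.ofReal_tsum_of_nonneg (fun w : W => cellForm_nonneg hr hD w h) hs).symm

lemma summable_of_Psi_lt_top (hr : 0 < r) (hD : ∀ u, 0 ≤ D u u) {h : Plane → ℝ}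
    (hh : Psi W r D h < ⊤) : Summable fun w : W => cellForm r D w h h := by
  refine (ENNReal.summable_toReal hh.ne).congr fun w => ?_
  exact ENNReal.toReal_ofReal (cellForm_nonneg hr hD w h)

lemma SolvesRenorm.le_energy (hsol : SolvesRenorm W r lam D) (hr : 0 < r)
    (hD : ∀ u, 0 ≤ D u u) {h : Plane → ℝ} (hc : ContinuousOn h (closure (V1 W)))
    (hs : Summable fun w : W => cellForm r D w h h) {u : Fin 3 → ℝ} (hu : ∀ i, h (q i) = u i) :
    lam * D u u ≤ ∑' w : W, cellForm r D w h h := by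
  have hP := Psi_eq hr hD hs
  have h1 : renorm W r D u ≤ Psi W r D h :=
    iInf₂_le h ⟨⟨hc, by rw [hP]; exact ENNReal.ofReal_lt_top⟩, hu⟩
  rw [hsol u, hP] at h1
  exact (ENNReal.ofReal_le_ofReal_iff (tsum_nonneg fun w : W => cellForm_nonneg hr hD w h)).1 h1

lemma SolvesRenorm.exists_energy_le (hsol : SolvesRenorm W r lam D) (hr : 0 < r)
    (hD : ∀ u, 0 ≤ D u u) (hlam : 0 < lam) (u : Fin 3 → ℝ) {ε : ℝ} (hε : 0 < ε) :
    ∃ h : Plane → ℝ, ContinuousOn h (closure (V1 W)) ∧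
      (Summable fun w : W => cellForm r D w h h) ∧ (∀ i, h (q i) = u i) ∧
      ∑' w : W, cellForm r D w h h ≤ lam * D u u + ε := by
  have h0 : 0 ≤ lam * D u u := mul_nonneg hlam.le (hD u)
  have h1 : renorm W r D u < ENNReal.ofReal (lam * D u u + ε) := by
    rw [hsol u]; exact (ENNReal.ofReal_lt_ofReal_iff (by linarith)).2 (by linarith)
  simp only [renorm, iInf_lt_iff] at h1
  obtain ⟨h, ⟨⟨hc, hf⟩, hu⟩, hlt⟩ := h1
  have hs := summable_of_Psi_lt_top hr hD hf
  rw [Psi_eq hr hD hs] at hlt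
  exact ⟨h, hc, hs, hu, ((ENNReal.ofReal_lt_ofReal_iff (by linarith)).1 hlt).le⟩

lemma pullback_add_smul (w : List (Fin 3)) (h φ : Plane → ℝ) (t : ℝ) :
    pullback w (h + t • φ) = pullback w h + t • pullback w φ := rfl

/-- `h` is a minimizing sequence for the energy with boundary values `u`. -/
structure IsMinimizing (W : Set (List (Fin 3))) (r lam : ℝ)
    (D : LinearMap.BilinForm ℝ (Fin 3 → ℝ)) (u : Fin 3 → ℝ) (h : ℕ → Plane → ℝ) : Prop where
  cont : ∀ n, ContinuousOn (h n) (closure (V1 W))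
  summable : ∀ n, Summable fun w : W => cellForm r D w (h n) (h n)
  boundary : ∀ n i, h n (q i) = u i
  bound : ∃ ε : ℕ → ℝ, Tendsto ε atTop (𝓝 0) ∧
    ∀ n, ∑' w : W, cellForm r D w (h n) (h n) ≤ lam * D u u + ε n

/-- The first variation of the energy along a minimizing sequence, in the direction of a function
`φ` which vanishes on all but finitely many cells. -/
lemma IsMinimizing.tendsto_variation {u : Fin 3 → ℝ} {h : ℕ → Plane → ℝ}
    (hm : IsMinimizing W r lam D u h) (hsol : SolvesRenorm W r lam D) (hr : 0 < r)
    (hD : ∀ u, 0 ≤ D u u) (hsymm : ∀ u v, D u v = D v u) {φ : Plane → ℝ}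
    (hφ : ContinuousOn φ (closure (V1 W))) (S : Finset W)
    (hS : ∀ w : W, w ∉ S → pullback w φ = 0) :
    Tendsto (fun n => ∑ w ∈ S, cellForm r D w (h n) φ) atTop
      (𝓝 (lam * D u (fun i => φ (q i)))) := by
  obtain ⟨ε, hε, hb⟩ := hm.bound
  set φ₀ : Fin 3 → ℝ := fun i => φ (q i) with hφ₀
  set L : ℕ → ℝ := fun n => ∑ w ∈ S, cellForm r D w (h n) φ with hL
  set Q : ℝ := ∑ w ∈ S, cellForm r D w φ φ with hQ
  -- `h n + t • φ` competes for the boundary values `u + t • φ₀`, where `φ₀` need not vanish. Only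
  -- finitely many cells change, so the energy is an explicit quadratic in `t`.
  have hvar : ∀ n (t : ℝ), 2 * t * (lam * D u φ₀ - L n) ≤ ε n + t ^ 2 * (Q - lam * D φ₀ φ₀) := by
    intro n t
    set g : W → ℝ := fun w => 2 * t * cellForm r D w (h n) φ + t ^ 2 * cellForm r D w φ φ with hg
    have hgS : HasSum g (∑ w ∈ S, g w) := by
      refine hasSum_sum_of_ne_finset_zero fun w hw => ?_
      simp [hg, cellForm, hS w hw]
    have hgL : ∑ w ∈ S, g w = 2 * t * L n + t ^ 2 * Q := by
      simp only [hg, hL, hQ, Finset.sum_add_distrib, Finset.mul_sum]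
    have hsum : HasSum (fun w : W => cellForm r D w (h n + t • φ) (h n + t • φ))
        (∑' w : W, cellForm r D w (h n) (h n) + (2 * t * L n + t ^ 2 * Q)) := by
      rw [← hgL]
      convert (hm.summable n).hasSum.add hgS using 2 with w
      simp only [hg, cellForm, pullback_add_smul, map_add, map_smul, LinearMap.add_apply,
        LinearMap.smul_apply, smul_eq_mul, hsymm (pullback w φ) (pullback w (h n))]
      ring
    have hle := hsol.le_energy hr hD (u := u + t • φ₀)
      ((hm.cont n).add (hφ.const_smul t)) hsum.summable
      (fun i => by simp [hφ₀, hm.boundary n i])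
    rw [hsum.tsum_eq] at hle
    simp only [map_add, map_smul, LinearMap.add_apply,
        LinearMap.smul_apply, smul_eq_mul, hsymm φ₀ u] at hle
    have := hb n
    nlinarith
  set K : ℝ := |Q - lam * D φ₀ φ₀| + 1 with hK
  have hKpos : 0 < K := by positivity
  have hsq : ∀ n, (lam * D u φ₀ - L n) ^ 2 ≤ K * ε n := by
    intro n
    set x := lam * D u φ₀ - L n with hx
    -- `t = x / K` maximizes `2 t x - K t²`; the `+ 1` in `K` makes the division legitimate.
    have h1 := hvar n (x / K)
    have h2 : (x / K) ^ 2 * (Q - lam * D φ₀ φ₀) ≤ (x / K) ^ 2 * K :=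
      mul_le_mul_of_nonneg_left (by rw [hK]; linarith [le_abs_self (Q - lam * D φ₀ φ₀)])
        (sq_nonneg _)
    have h3 : (x / K) ^ 2 * K = x ^ 2 / K := by field_simp
    have h4 : 2 * (x / K) * x = 2 * (x ^ 2 / K) := by ring
    have h5 : x ^ 2 / K ≤ ε n := by linarith
    rw [div_le_iff₀ hKpos] at h5
    linarith
  have h0 : Tendsto (fun n => (lam * D u φ₀ - L n) ^ 2) atTop (𝓝 0) :=
    squeeze_zero (fun n => sq_nonneg _) hsq (by simpa using hε.const_mul K)
  have h1 : Tendsto (fun n => lam * D u φ₀ - L n) atTop (𝓝 0) := by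
    refine (tendsto_zero_iff_abs_tendsto_zero _).2 ?_
    have := h0.sqrt
    simpa [Real.sqrt_sq_eq_abs, Function.comp_def] using this
  simpa using (tendsto_const_nhds (x := lam * D u φ₀)).sub h1

end

/-! ### Comparison of two solutions -/

section
variable {W : Set (List (Fin 3))} {r lam lam' α : ℝ}
  {D₁ D₂ : LinearMap.BilinForm ℝ (Fin 3 → ℝ)} {f : Fin 3 → ℝ}

lemma cellForm_mono (hr : 0 < r) (hle : ∀ u, α * D₂ u u ≤ D₁ u u) (w : List (Fin 3))
    (h : Plane → ℝ) : α * cellForm r D₂ w h h ≤ cellForm r D₁ w h h := by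
  have := mul_le_mul_of_nonneg_left (hle (pullback w h))
    (zpow_pos hr (-(w.length : ℤ) + 1)).le
  unfold cellForm; linarith

lemma summable_of_le (hr : 0 < r) (h₂ : ∀ u, 0 ≤ D₂ u u) (hα : 0 < α)
    (hle : ∀ u, α * D₂ u u ≤ D₁ u u) {h : Plane → ℝ}
    (hs : Summable fun w : W => cellForm r D₁ w h h) :
    Summable fun w : W => cellForm r D₂ w h h := by
  have : Summable fun w : W => α * cellForm r D₂ w h h :=
    hs.of_nonneg_of_le (fun w => mul_nonneg hα.le (cellForm_nonneg hr h₂ w h))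
      fun w => cellForm_mono hr hle w h
  exact (summable_mul_left_iff hα.ne').1 this

/-- A near-minimizer for `D₁` at `f` competes for `D₂`, so `α lam' D₂ f f ≤ lam D₁ f f + ε`, and the
touching at `f` identifies `α D₂ f f` with `D₁ f f`. -/
lemma SolvesRenorm.eigenvalue_le (hs₁ : SolvesRenorm W r lam D₁) (hs₂ : SolvesRenorm W r lam' D₂)
    (hr : 0 < r) (h₁ : ∀ u, 0 ≤ D₁ u u) (h₂ : ∀ u, 0 ≤ D₂ u u) (hlam : 0 < lam) (hα : 0 < α)
    (hle : ∀ u, α * D₂ u u ≤ D₁ u u) (hf : D₁ f f = α * D₂ f f) (hfpos : 0 < D₁ f f) :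
    lam' ≤ lam := by
  refine le_of_mul_le_mul_right ?_ hfpos
  refine le_of_forall_pos_le_add fun ε hε => ?_
  obtain ⟨h, hc, hs, hu, hE⟩ := hs₁.exists_energy_le hr h₁ hlam f hε
  have hs' := summable_of_le hr h₂ hα hle hs
  have h3 := hs₂.le_energy hr h₂ hc hs' hu
  have h4 : α * ∑' w : W, cellForm r D₂ w h h ≤ ∑' w : W, cellForm r D₁ w h h := by
    rw [← tsum_mul_left]
    exact (hs'.mul_left α).tsum_le_tsum (fun w => cellForm_mono hr hle w h) hs
  have := mul_le_mul_of_nonneg_left h3 hα.le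
  calc lam' * D₁ f f = α * (lam' * D₂ f f) := by rw [hf]; ring
    _ ≤ _ := by linarith

/-- If `D₁ ≥ α D₂` with equality at `f`, some sequence is minimizing for both forms, and on every
cell it becomes asymptotically a null vector of `D₁ - α D₂`. -/
lemma exists_common_minimizing (hs₁ : SolvesRenorm W r lam D₁) (hs₂ : SolvesRenorm W r lam D₂)
    (hr : 0 < r) (h₁ : ∀ u, 0 ≤ D₁ u u) (h₂ : ∀ u, 0 ≤ D₂ u u) (hlam : 0 < lam) (hα : 0 < α)
    (hle : ∀ u, α * D₂ u u ≤ D₁ u u) (hf : D₁ f f = α * D₂ f f) :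
    ∃ h : ℕ → Plane → ℝ, IsMinimizing W r lam D₁ f h ∧ IsMinimizing W r lam D₂ f h ∧
      ∀ w : W, Tendsto (fun n => D₁ (pullback w (h n)) (pullback w (h n)) -
        α * D₂ (pullback w (h n)) (pullback w (h n))) atTop (𝓝 0) := by
  have hε : ∀ n : ℕ, (0 : ℝ) < 1 / ((n : ℝ) + 1) := fun n => by positivity
  choose h hc hs hu hE using fun n : ℕ => hs₁.exists_energy_le hr h₁ hlam f (hε n)
  have hs' := fun n => summable_of_le hr h₂ hα hle (hs n)
  have hdiff : ∀ n (w : W), 0 ≤ cellForm r D₁ w (h n) (h n) - α * cellForm r D₂ w (h n) (h n) :=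
    fun n w => sub_nonneg.2 (cellForm_mono hr hle w (h n))
  have hsub : ∀ n, HasSum
      (fun w : W => cellForm r D₁ w (h n) (h n) - α * cellForm r D₂ w (h n) (h n))
      (∑' w : W, cellForm r D₁ w (h n) (h n) - α * ∑' w : W, cellForm r D₂ w (h n) (h n)) :=
    fun n => (hs n).hasSum.sub ((hs' n).hasSum.mul_left α)
  have h0 := tendsto_one_div_add_atTop_nhds_zero_nat (𝕜 := ℝ)
  refine ⟨h, ⟨hc, hs, hu, _, h0, hE⟩, ⟨hc, hs', hu, fun n => α⁻¹ * (1 / ((n : ℝ) + 1)),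
    by simpa using h0.const_mul α⁻¹, fun n => ?_⟩, fun w => ?_⟩
  · have h1 := (hsub n).nonneg (hdiff n)
    have h2 := hE n
    rw [hf] at h2
    rw [← mul_le_mul_iff_of_pos_left hα, mul_add, mul_inv_cancel_left₀ hα.ne']
    linarith
  · have hw : (0 : ℝ) < r ^ (-((w : List (Fin 3)).length : ℤ) + 1) := zpow_pos hr _
    -- The nonnegative gaps of all cells add up to at most `lam D₁ f f + ε - α lam D₂ f f = ε`, so
    -- each single gap is at most `ε`. The common eigenvalue is essential here.
    have hb : ∀ n, cellForm r D₁ w (h n) (h n) - α * cellForm r D₂ w (h n) (h n) ≤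
        1 / ((n : ℝ) + 1) := fun n => by
      have h1 := le_hasSum (hsub n) w fun w' _ => hdiff n w'
      have h2 := hE n
      have h3 := mul_le_mul_of_nonneg_left (hs₂.le_energy hr h₂ (hc n) (hs' n) (hu n)) hα.le
      rw [hf] at h2
      linarith
    have h1 := (squeeze_zero (fun n => hdiff n w) hb h0).const_mul
      (r ^ (-((w : List (Fin 3)).length : ℤ) + 1))⁻¹
    rw [mul_zero] at h1
    refine h1.congr fun n => ?_
    simp only [cellForm]
    field_simp

end


/-! ### Currents at the vertices -/

lemma pullback_top_zero {w : List (Fin 3)} (hw : w ∈ topWords) {n : ℕ} (hn : w.length = n + 1)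
    (h : Plane → ℝ) : pullback w h 0 = h (pt n (pos w)) := by
  rw [pullback, Fword_q_zero hw hn]

lemma pullback_top_one {w : List (Fin 3)} (hw : w ∈ topWords) {n : ℕ} (hn : w.length = n + 1)
    (h : Plane → ℝ) : pullback w h 1 = h (pt (n + 1) (pos w)) := by
  rw [pullback, Fword_q_one hw hn]

lemma pullback_top_two {w : List (Fin 3)} (hw : w ∈ topWords) {n : ℕ} (hn : w.length = n + 1)
    (h : Plane → ℝ) : pullback w h 2 = h (pt (n + 1) (pos w + rho ^ n)) := by
  rw [pullback, Fword_q_two hw hn]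

lemma bump_pt (n m : ℕ) (t s : ℝ) :
    bump (pt n t) (pt m s) = if m = n ∧ s = t then 1 else 0 := by
  simp [bump, Set.indicator_apply, pt_inj]

lemma pullback_bump {w : List (Fin 3)} (hw : w ∈ topWords) {m : ℕ} (hm : w.length = m + 1)
    (n : ℕ) (t : ℝ) : pullback w (bump (pt n t)) =
      ![if m = n ∧ pos w = t then 1 else 0, if m + 1 = n ∧ pos w = t then 1 else 0,
        if m + 1 = n ∧ pos w + rho ^ m = t then 1 else 0] := by
  ext i
  fin_cases i
  · exact (pullback_top_zero hw hm _).trans (bump_pt _ _ _ _)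
  · exact (pullback_top_one hw hm _).trans (bump_pt _ _ _ _)
  · exact (pullback_top_two hw hm _).trans (bump_pt _ _ _ _)

/-- The symmetric form with conductances `A, A, B` on the edges `01, 02, 12`. -/
def IsSymmForm (A B : ℝ) (D : LinearMap.BilinForm ℝ (Fin 3 → ℝ)) : Prop :=
  ∀ u v, D u v = A * (u 0 - u 1) * (v 0 - v 1) + A * (u 0 - u 2) * (v 0 - v 2)
    + B * (u 1 - u 2) * (v 1 - v 2)

/-- The sum of the increments from the top of a cell to its two other vertices. -/
def slope (w : List (Fin 3)) (h : Plane → ℝ) : ℝ :=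
  (pullback w h 1 - pullback w h 0) + (pullback w h 2 - pullback w h 0)

/-- The deviation of `h` on a cell from a multiple of the function with increments `p, s`. -/
def deviation (p s : ℝ) (w : List (Fin 3)) (h : Plane → ℝ) : ℝ :=
  (pullback w h 1 - pullback w h 0) * s - (pullback w h 2 - pullback w h 0) * p

/-- A minimizing sequence which is asymptotically a multiple of a fixed function on each cell. -/
structure Setup (W : Set (List (Fin 3))) (r lam A B p s : ℝ)
    (D : LinearMap.BilinForm ℝ (Fin 3 → ℝ)) (f : Fin 3 → ℝ) (h : ℕ → Plane → ℝ) : Prop where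
  sel : IsWordSelection W
  r_pos : 0 < r
  lam_pos : 0 < lam
  A_pos : 0 < A
  B_nonneg : 0 ≤ B
  form : IsSymmForm A B D
  sol : SolvesRenorm W r lam D
  min : IsMinimizing W r lam D f h
  inc_one : f 1 - f 0 = p
  inc_two : f 2 - f 0 = s
  inc_add : p + s = 1
  dev : ∀ w : W, Tendsto (fun n => deviation p s w (h n)) atTop (𝓝 0)

namespace Setup

variable {W : Set (List (Fin 3))} {r lam A B p s : ℝ} {D : LinearMap.BilinForm ℝ (Fin 3 → ℝ)}
  {f : Fin 3 → ℝ} {h : ℕ → Plane → ℝ}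

lemma form_nonneg (hS : Setup W r lam A B p s D f h) (u : Fin 3 → ℝ) : 0 ≤ D u u := by
  have := hS.A_pos.le
  have := hS.B_nonneg
  rw [hS.form]
  simp only [mul_assoc, ← pow_two]
  positivity

lemma form_symm (hS : Setup W r lam A B p s D f h) (u v : Fin 3 → ℝ) : D u v = D v u := by
  rw [hS.form, hS.form]; ring

/-- As `p + s = 1`, slope and deviation are coordinates for the two increments of a cell; the
deviation dies out along the sequence. -/
lemma inc_eq (hS : Setup W r lam A B p s D f h) (w : List (Fin 3)) (g : Plane → ℝ) :
    pullback w g 1 - pullback w g 0 = slope w g * p + deviation p s w g ∧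
    pullback w g 2 - pullback w g 0 = slope w g * s - deviation p s w g := by
  have h1 : s = 1 - p := by linarith [hS.inc_add]
  subst h1
  constructor <;> simp only [slope, deviation] <;> ring

lemma tendsto_inc (hS : Setup W r lam A B p s D f h) (w : W) {γ : ℝ}
    (hγ : Tendsto (fun n => slope w (h n)) atTop (𝓝 γ)) :
    Tendsto (fun n => pullback w (h n) 1 - pullback w (h n) 0) atTop (𝓝 (γ * p)) ∧
    Tendsto (fun n => pullback w (h n) 2 - pullback w (h n) 0) atTop (𝓝 (γ * s)) := by
  constructor
  · have := (hγ.mul_const p).add (hS.dev w)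
    rw [add_zero] at this
    exact this.congr fun n => ((hS.inc_eq w (h n)).1).symm
  · have := (hγ.mul_const s).sub (hS.dev w)
    rw [sub_zero] at this
    exact this.congr fun n => ((hS.inc_eq w (h n)).2).symm

/-- Symmetry enters here: with equal conductances at the top, the current there sees only the sum of
the two increments. -/
lemma form_single_zero (hS : Setup W r lam A B p s D f h) (w : List (Fin 3)) (g : Plane → ℝ) :
    D (pullback w g) ![1, 0, 0] = -(A * slope w g) := by
  rw [hS.form]; simp [slope]; ring

/-- Up to the deviation, `x` is the share of the cell's current that passes through its lower left
vertex; `y` plays the same role on the right. -/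
lemma form_single_one (hS : Setup W r lam A B p s D f h) {x : ℝ} (hx : A * x = A * p + B * (p - s))
    (w : List (Fin 3)) (g : Plane → ℝ) :
    D (pullback w g) ![0, 1, 0] = A * x * slope w g + (A + 2 * B) * deviation p s w g := by
  obtain ⟨h1, h2⟩ := hS.inc_eq w g
  rw [hS.form, hx]; simp
  linear_combination (A + B) * h1 - B * h2

lemma form_single_two (hS : Setup W r lam A B p s D f h) {y : ℝ} (hy : A * y = A * s + B * (s - p))
    (w : List (Fin 3)) (g : Plane → ℝ) :
    D (pullback w g) ![0, 0, 1] = A * y * slope w g - (A + 2 * B) * deviation p s w g := by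
  obtain ⟨h1, h2⟩ := hS.inc_eq w g
  rw [hS.form, hy]; simp
  linear_combination (A + B) * h2 - B * h1

/-- Kirchhoff's law at the vertex `q₀`. -/
lemma tendsto_slope_root (hS : Setup W r lam A B p s D f h) (w : W)
    (hw : (w : List (Fin 3)).length = 1) (hp : pos w = 0) :
    Tendsto (fun n => slope w (h n)) atTop (𝓝 lam) := by
  have hcur : ∀ w' : W, w' ≠ w → pullback w' (bump (pt 0 0)) = 0 := fun w' hne => by
    have hw' := hS.sel.subset w'.2
    obtain ⟨m, hm⟩ := exists_length hw'
    have : ¬ (m = 0 ∧ pos w' = 0) := fun ⟨h1, h2⟩ => hne <| Subtype.ext <|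
      hS.sel.eq_of_pos w'.2 w.2 (by omega) (by rw [h2, hp])
    rw [pullback_bump hw' hm, if_neg this]
    ext i; fin_cases i <;> simp
  have hv := hS.min.tendsto_variation hS.sol hS.r_pos hS.form_nonneg hS.form_symm
    (continuousOn_bump hS.sel.subset 0 0) {w} (fun w' h => hcur w' (by simpa using h))
  have hb : (fun i => bump (pt 0 0) (q i)) = ![1, 0, 0] := by
    ext i
    fin_cases i
    · simp [bump, pt_zero_zero]
    · simp [bump, pt_ne_q_one]
    · simp [bump, pt_ne_q_two]
  have hwb : pullback w (bump (pt 0 0)) = ![1, 0, 0] := by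
    rw [pullback_bump (hS.sel.subset w.2) (m := 0) hw]; simp [hp]
  -- The boundary function has slope `p + s = 1`; this fixes the limit at the root as `lam`.
  have hf : D f ![1, 0, 0] = -A := by
    rw [hS.form]; simp
    linear_combination (-A) * (hS.inc_one + hS.inc_two + hS.inc_add)
  rw [hb, hf] at hv
  have h2 := hv.const_mul (-A⁻¹)
  have hA := hS.A_pos.ne'
  rw [show -A⁻¹ * (lam * -A) = lam by field_simp] at h2
  refine h2.congr fun n => ?_
  simp only [Finset.sum_singleton, cellForm, hwb, hS.form_single_zero, hw]
  simp; field_simp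

/-- Kirchhoff's law at the other vertices: the current into the cell `w` comes from the cells in
`S₁` and `S₂` which have the top of `w` as lower left and lower right vertex. -/
lemma tendsto_slope (hS : Setup W r lam A B p s D f h) {x y : ℝ}
    (hx : A * x = A * p + B * (p - s)) (hy : A * y = A * s + B * (s - p)) {k : ℕ} (w : W)
    (hw : (w : List (Fin 3)).length = k + 2) (S₁ S₂ : Finset W)
    (h₁ : ∀ v : W, v ∈ S₁ ↔ (v : List (Fin 3)).length = k + 1 ∧ pos v = pos w)
    (h₂ : ∀ v : W, v ∈ S₂ ↔ (v : List (Fin 3)).length = k + 1 ∧ pos v + rho ^ k = pos w)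
    {γ : W → ℝ} (hγ : ∀ v ∈ S₁ ∪ S₂, Tendsto (fun n => slope v (h n)) atTop (𝓝 (γ v))) :
    Tendsto (fun n => slope w (h n)) atTop
      (𝓝 (r * (x * ∑ v ∈ S₁, γ v + y * ∑ v ∈ S₂, γ v))) := by
  classical
  set P := pt (k + 1) (pos w) with hP
  have hρ : rho ^ k ≠ 0 := (pow_pos rho_pos k).ne'
  have hbw : pullback w (bump P) = ![1, 0, 0] := by
    rw [pullback_bump (hS.sel.subset w.2) hw]; simp
  have hb1 : ∀ v ∈ S₁, pullback v (bump P) = ![0, 1, 0] := fun v hv => by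
    obtain ⟨hl, hp⟩ := (h₁ v).1 hv
    rw [pullback_bump (hS.sel.subset v.2) hl]; simp [hp, hρ]
  have hb2 : ∀ v ∈ S₂, pullback v (bump P) = ![0, 0, 1] := fun v hv => by
    obtain ⟨hl, hp⟩ := (h₂ v).1 hv
    rw [pullback_bump (hS.sel.subset v.2) hl, ← hp]; simp [hρ]
  have hd : Disjoint S₁ S₂ := Finset.disjoint_left.2 fun v hv1 hv2 => hρ <| by
    linarith [((h₁ v).1 hv1).2, ((h₂ v).1 hv2).2]
  have hwS : w ∉ S₁ ∪ S₂ := fun hmem => by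
    rcases Finset.mem_union.1 hmem with h | h
    · have := ((h₁ w).1 h).1; omega
    · have := ((h₂ w).1 h).1; omega
  have hv := hS.min.tendsto_variation hS.sol hS.r_pos hS.form_nonneg hS.form_symm
    (continuousOn_bump hS.sel.subset (k + 1) (pos w)) (insert w (S₁ ∪ S₂)) (fun v hv => by
      have hv' := hS.sel.subset v.2
      obtain ⟨m, hm⟩ := exists_length hv'
      simp only [Finset.mem_insert, Finset.mem_union, not_or] at hv
      have e0 : ¬ (m = k + 1 ∧ pos v = pos w) := fun ⟨e1, e2⟩ => hv.1 <| Subtype.ext <|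
        hS.sel.eq_of_pos v.2 w.2 (by omega) e2
      have e1 : ¬ (m + 1 = k + 1 ∧ pos v = pos w) := fun ⟨e1, e2⟩ =>
        hv.2.1 ((h₁ v).2 ⟨by omega, e2⟩)
      have e2 : ¬ (m + 1 = k + 1 ∧ pos v + rho ^ m = pos w) := fun ⟨e1, e2⟩ =>
        hv.2.2 ((h₂ v).2 ⟨by omega, by rwa [← Nat.succ.inj e1]⟩)
      rw [pullback_bump hv' hm, if_neg e0, if_neg e1, if_neg e2]
      ext i; fin_cases i <;> rfl)
  -- The vertex is not in `V₀`, so the first variation has limit zero: the currents balance.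
  have hb : (fun i => bump (pt (k + 1) (pos w)) (q i)) = 0 := by
    ext i
    fin_cases i
    · simp [bump, ← pt_zero_zero, pt_inj]
    · simp [bump, pt_ne_q_one]
    · simp [bump, pt_ne_q_two]
  have hA := hS.A_pos.ne'
  have hr := hS.r_pos.ne'
  -- The cell `w` is one level below its parents; the extra `r⁻¹` in its weight becomes the factor
  -- `r` in the recursion.
  have hk : r ^ (-((k : ℤ) + 2) + 1) = r ^ (-(k : ℤ)) * r⁻¹ := by
    rw [← zpow_sub_one₀ hr]; congr 1; ring
  have hk' : r ^ (-((k : ℤ) + 1) + 1) = r ^ (-(k : ℤ)) := by congr 1; ring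
  have hkpos : r ^ (-(k : ℤ)) ≠ 0 := (zpow_pos hS.r_pos _).ne'
  rw [hb, map_zero, mul_zero] at hv
  have hin : Tendsto (fun n => ∑ v ∈ S₁, (A * x * slope v (h n) +
        (A + 2 * B) * deviation p s v (h n)) +
      ∑ v ∈ S₂, (A * y * slope v (h n) - (A + 2 * B) * deviation p s v (h n))) atTop
      (𝓝 (∑ v ∈ S₁, (A * x * γ v + (A + 2 * B) * 0) +
        ∑ v ∈ S₂, (A * y * γ v - (A + 2 * B) * 0))) := by
    refine (tendsto_finsetSum _ fun v hv => ?_).add (tendsto_finsetSum _ fun v hv => ?_)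
    · exact ((hγ v (Finset.mem_union_left _ hv)).const_mul _).add ((hS.dev v).const_mul _)
    · exact ((hγ v (Finset.mem_union_right _ hv)).const_mul _).sub ((hS.dev v).const_mul _)
  have hlim := (hin.const_mul (r / A)).sub (hv.const_mul (r / A * (r ^ (-(k : ℤ)))⁻¹))
  convert hlim using 2 with n
  · rw [Finset.sum_insert hwS, Finset.sum_union hd]
    have s1 : ∑ v ∈ S₁, cellForm r D v (h n) (bump (pt (k + 1) (pos w))) =
        r ^ (-(k : ℤ)) * ∑ v ∈ S₁, (A * x * slope v (h n) +
          (A + 2 * B) * deviation p s v (h n)) := by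
      rw [Finset.mul_sum]
      refine Finset.sum_congr rfl fun v hv => ?_
      rw [cellForm, hb1 v hv, hS.form_single_one hx, ((h₁ v).1 hv).1]
      push_cast; rw [hk']
    have s2 : ∑ v ∈ S₂, cellForm r D v (h n) (bump (pt (k + 1) (pos w))) =
        r ^ (-(k : ℤ)) * ∑ v ∈ S₂, (A * y * slope v (h n) -
          (A + 2 * B) * deviation p s v (h n)) := by
      rw [Finset.mul_sum]
      refine Finset.sum_congr rfl fun v hv => ?_
      rw [cellForm, hb2 v hv, hS.form_single_two hy, ((h₂ v).1 hv).1]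
      push_cast; rw [hk']
    have s0 : cellForm r D w (h n) (bump (pt (k + 1) (pos w))) =
        -(r ^ (-(k : ℤ)) * r⁻¹ * (A * slope w (h n))) := by
      rw [cellForm, hbw, hS.form_single_zero, hw]
      push_cast; rw [hk]; ring
    rw [s0, s1, s2]
    field_simp
    ring
  · simp only [mul_zero, add_zero, sub_zero, ← Finset.mul_sum]
    field_simp

end Setup


/-! ### Positions of short words -/

lemma pos_of_length_one {w : List (Fin 3)} (hw : w ∈ topWords) (hl : w.length = 1) :
    pos w = 0 := by
  obtain ⟨v, hv, rfl⟩ := hw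
  obtain rfl : v = [] := by simpa using hl
  simp [pos]

lemma exists_pos_tail {w : List (Fin 3)} (hw : w ∈ topWords) {n : ℕ} (hl : w.length = n + 2) :
    ∃ w' ∈ topWords, w'.length = n + 1 ∧ (pos w = rho * pos w' ∨ pos w = 1 + rho * pos w') := by
  obtain ⟨v, hv, rfl⟩ := hw
  cases v with
  | nil => simp at hl
  | cons i v =>
    refine ⟨v ++ [0], ⟨v, fun h => hv (by simp [h]), rfl⟩, by simpa using hl, ?_⟩
    by_cases hi : i = 2 <;> simp [pos, hi]

lemma pos_of_length_two {w : List (Fin 3)} (hw : w ∈ topWords) (hl : w.length = 2) :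
    pos w = 0 ∨ pos w = 1 := by
  obtain ⟨w', hw', hl', h⟩ := exists_pos_tail hw hl
  simpa [pos_of_length_one hw' hl'] using h

lemma pos_of_length_three {w : List (Fin 3)} (hw : w ∈ topWords) (hl : w.length = 3) :
    pos w = 0 ∨ pos w = rho ∨ pos w = 1 ∨ pos w = 1 + rho := by
  obtain ⟨w', hw', hl', h⟩ := exists_pos_tail hw hl
  rcases pos_of_length_two hw' hl' with h' | h' <;> rw [h'] at h <;> simp at h <;> tauto

/-- Such lists serve to exclude unexpected parents of a cell. Positions from `1` on are lumped
together because only values below `1` have to be excluded. -/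
lemma pos_of_length_four {w : List (Fin 3)} (hw : w ∈ topWords) (hl : w.length = 4) :
    pos w = 0 ∨ pos w = rho ∨ pos w = 1 - rho ∨ 1 ≤ pos w := by
  obtain ⟨w', hw', hl', h⟩ := exists_pos_tail hw hl
  have h1 := rho_pos
  have h2 := rho_sq
  rcases pos_of_length_three hw' hl' with h' | h' | h' | h' <;> rw [h'] at h <;>
    rcases h with h | h
  · left; linarith
  · right; right; right; linarith
  · right; right; left; linarith
  · right; right; right; nlinarith
  · right; left; linarith
  · right; right; right; linarith
  · right; right; right; linarith
  · right; right; right; nlinarith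

lemma pos_nil : pos [] = 0 := rfl

lemma pos_one_cons (v : List (Fin 3)) : pos (1 :: v) = rho * pos v := by
  simp [pos]

lemma pos_two_cons (v : List (Fin 3)) : pos (2 :: v) = 1 + rho * pos v := by
  simp [pos]

/-- The consistency conditions at the vertices `122 = 211` and `12122 = 12211` have no solution. -/
lemma inconsistent_increments {r lam A B p s x y : ℝ} (hr : 0 < r) (hr1 : r < 1) (hlam : 0 < lam)
    (hA : 0 < A) (hB : 0 ≤ B) (hps : p + s = 1)
    (hx : A * x = A * p + B * (p - s)) (hy : A * y = A * s + B * (s - p))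
    (h₁ : lam * p + r * (x * lam) * s + r * (y * (r * (x * lam))) * s =
      lam * s + r * (y * lam) * p + r * (x * (r * (y * lam))) * p)
    (h₂ : r * (y * (r * (x * lam))) * p + r * (x * (r * (y * (r * (x * lam))))) * s +
        r * (y * (r * (x * (r * (y * (r * (x * lam))))))) * s =
      r * (y * (r * (x * lam))) * s +
        r * (x * (r * (x * (r * (y * lam)))) + y * (r * (y * (r * (x * lam))))) * p +
        r * (x * (r * (x * (r * (x * (r * (y * lam)))) + y * (r * (y * (r * (x * lam)))))))
          * p) : False := by
  have hxy : x + y = 1 := by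
    refine mul_left_cancel₀ hA.ne' ?_
    linear_combination hx + hy + A * hps
  -- First cycle: with `κ = B / A` the condition factors as `(p - s) (1 + r κ - r² x y) = 0`. Since
  -- `x + y = 1` gives `x y ≤ 1/4` and `r < 1`, the second factor is positive.
  have hd : p = s := by
    obtain ⟨κ, hκ⟩ : ∃ κ, B = A * κ := ⟨B / A, by field_simp⟩
    have hκ0 : 0 ≤ κ := nonneg_of_mul_nonneg_right (hκ ▸ hB) hA
    have hx' : x = p + κ * (p - s) := mul_left_cancel₀ hA.ne' (by rw [hx, hκ]; ring)
    have hs' : s = 1 - p := by linarith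
    have hy' : y = 1 - x := by linarith
    have hE : p + r * x * s + r * (r * x * y) * s = s + r * y * p + r * (r * x * y) * p :=
      mul_left_cancel₀ hlam.ne' (by linear_combination h₁)
    have hq : (p - s) * (1 + r * κ - r ^ 2 * (x * y)) = 0 := by
      have : p * y - s * x = -(κ * (p - s)) := by rw [hy', hx', hs']; ring
      linear_combination hE + r * this
    have hxyle : x * y ≤ 1 / 4 := by rw [hy']; nlinarith [sq_nonneg (2 * x - 1)]
    have : 0 < 1 + r * κ - r ^ 2 * (x * y) := by
      have : 0 ≤ r * κ := by positivity
      have : r ^ 2 * (x * y) ≤ r ^ 2 * (1 / 4) := by gcongr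
      nlinarith
    linarith [(mul_eq_zero.1 hq).resolve_right this.ne']
  have hp2 : p = 1 / 2 := by linarith
  have hs2 : s = 1 / 2 := by linarith
  have hx2 : x = 1 / 2 := mul_left_cancel₀ hA.ne' (by rw [hx, hp2, hs2]; ring)
  have hy2 : y = 1 / 2 := by linarith
  -- Second cycle: with all shares equal to `1/2`, the doubly fed cell makes the right side exceed
  -- the left by `lam r³ (2 + r) / 32`.
  rw [hp2, hs2, hx2, hy2] at h₂
  have : lam * r ^ 3 * (2 + r) = 0 := by linear_combination (-32 : ℝ) * h₂
  have : 0 < lam * r ^ 3 * (2 + r) := by positivity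
  linarith

lemma rho_cube : rho ^ 3 = 2 * rho - 1 := by
  have h := rho_sq
  linear_combination (rho - 1) * h

/-! ### Slopes of the cells along two cycles -/

namespace Setup

variable {W : Set (List (Fin 3))} {r lam A B p s : ℝ} {D : LinearMap.BilinForm ℝ (Fin 3 → ℝ)}
  {f : Fin 3 → ℝ} {h : ℕ → Plane → ℝ} {x y : ℝ} {k : ℕ}

/-- `hno` excludes a parent meeting the top of `w` with its lower right vertex, so a single current
feeds `w`. -/
lemma tendsto_slope_one (hS : Setup W r lam A B p s D f h)
    (hx : A * x = A * p + B * (p - s)) (hy : A * y = A * s + B * (s - p)) (w w₁ : W)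
    (hw : (w : List (Fin 3)).length = k + 2) (hw₁ : (w₁ : List (Fin 3)).length = k + 1)
    (hp : pos w₁ = pos w)
    (hno : ∀ v ∈ topWords, v.length = k + 1 → pos v + rho ^ k ≠ pos w) {γ : ℝ}
    (hγ : Tendsto (fun n => slope w₁ (h n)) atTop (𝓝 γ)) :
    Tendsto (fun n => slope w (h n)) atTop (𝓝 (r * (x * γ))) := by
  have := hS.tendsto_slope hx hy w hw {w₁} ∅ (fun v => ⟨fun hv => ?_, fun hv => ?_⟩)
    (fun v => ⟨fun hv => by simp at hv, fun hv => ?_⟩) (γ := fun _ => γ) (fun v hv => ?_)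
  · simpa using this
  · obtain rfl := Finset.mem_singleton.1 hv; exact ⟨hw₁, hp⟩
  · exact Finset.mem_singleton.2 <| Subtype.ext <|
      hS.sel.eq_of_pos v.2 w₁.2 (hv.1.trans hw₁.symm) (hv.2.trans hp.symm)
  · exact absurd hv.2 (hno v (hS.sel.subset v.2) hv.1)
  · obtain rfl : v = w₁ := by simpa using hv
    exact hγ

lemma tendsto_slope_two (hS : Setup W r lam A B p s D f h)
    (hx : A * x = A * p + B * (p - s)) (hy : A * y = A * s + B * (s - p)) (w w₂ : W)
    (hw : (w : List (Fin 3)).length = k + 2) (hw₂ : (w₂ : List (Fin 3)).length = k + 1)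
    (hp : pos w₂ + rho ^ k = pos w)
    (hno : ∀ v ∈ topWords, v.length = k + 1 → pos v ≠ pos w) {γ : ℝ}
    (hγ : Tendsto (fun n => slope w₂ (h n)) atTop (𝓝 γ)) :
    Tendsto (fun n => slope w (h n)) atTop (𝓝 (r * (y * γ))) := by
  have := hS.tendsto_slope hx hy w hw ∅ {w₂} (fun v => ⟨fun hv => by simp at hv, fun hv => ?_⟩)
    (fun v => ⟨fun hv => ?_, fun hv => ?_⟩) (γ := fun _ => γ) (fun v hv => ?_)
  · simpa using this
  · exact absurd hv.2 (hno v (hS.sel.subset v.2) hv.1)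
  · obtain rfl := Finset.mem_singleton.1 hv; exact ⟨hw₂, hp⟩
  · exact Finset.mem_singleton.2 <| Subtype.ext <|
      hS.sel.eq_of_pos v.2 w₂.2 (hv.1.trans hw₂.symm) (by linarith [hv.2])
  · obtain rfl : v = w₂ := by simpa using hv
    exact hγ

lemma tendsto_slope_both (hS : Setup W r lam A B p s D f h)
    (hx : A * x = A * p + B * (p - s)) (hy : A * y = A * s + B * (s - p)) (w w₁ w₂ : W)
    (hw : (w : List (Fin 3)).length = k + 2) (hw₁ : (w₁ : List (Fin 3)).length = k + 1)
    (hp₁ : pos w₁ = pos w) (hw₂ : (w₂ : List (Fin 3)).length = k + 1)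
    (hp₂ : pos w₂ + rho ^ k = pos w) {γ₁ γ₂ : ℝ}
    (hγ₁ : Tendsto (fun n => slope w₁ (h n)) atTop (𝓝 γ₁))
    (hγ₂ : Tendsto (fun n => slope w₂ (h n)) atTop (𝓝 γ₂)) :
    Tendsto (fun n => slope w (h n)) atTop (𝓝 (r * (x * γ₁ + y * γ₂))) := by
  classical
  have hne : w₂ ≠ w₁ := by
    rintro rfl
    linarith [pow_pos rho_pos k]
  have := hS.tendsto_slope hx hy w hw {w₁} {w₂} (fun v => ⟨fun hv => ?_, fun hv => ?_⟩)
    (fun v => ⟨fun hv => ?_, fun hv => ?_⟩)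
    (γ := fun v => if v = w₁ then γ₁ else γ₂) (fun v hv => ?_)
  · simpa [hne] using this
  · obtain rfl := Finset.mem_singleton.1 hv; exact ⟨hw₁, hp₁⟩
  · exact Finset.mem_singleton.2 <| Subtype.ext <|
      hS.sel.eq_of_pos v.2 w₁.2 (hv.1.trans hw₁.symm) (hv.2.trans hp₁.symm)
  · obtain rfl := Finset.mem_singleton.1 hv; exact ⟨hw₂, hp₂⟩
  · exact Finset.mem_singleton.2 <| Subtype.ext <|
      hS.sel.eq_of_pos v.2 w₂.2 (hv.1.trans hw₂.symm) (by linarith [hv.2])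
  · rcases Finset.mem_union.1 hv with hv | hv <;> obtain rfl := Finset.mem_singleton.1 hv
    · simpa using hγ₁
    · simpa [hne] using hγ₂

/-- The two paths `122` and `211` to the same vertex give inconsistent increments. -/
theorem contradiction (hS : Setup W r lam A B p s D f h) (hr1 : r < 1) : False := by
  have hA := hS.A_pos
  have hr := hS.r_pos
  have hlam := hS.lam_pos
  have g1 := rho_gt
  have g2 := rho_lt
  have gs := rho_sq
  have gc := rho_cube
  obtain ⟨x, hx⟩ : ∃ x, A * x = A * p + B * (p - s) :=
    ⟨(A * p + B * (p - s)) / A, by field_simp⟩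
  obtain ⟨y, hy⟩ : ∃ y, A * y = A * s + B * (s - p) :=
    ⟨(A * s + B * (s - p)) / A, by field_simp⟩
  have hword : ∀ v : List (Fin 3), (0 : Fin 3) ∉ v → ∃ w : W,
      (w : List (Fin 3)).length = v.length + 1 ∧ pos w = pos v := fun v hv => by
    obtain ⟨w, hw, h1⟩ := hS.sel.exists_word v hv
    exact ⟨⟨w, hw⟩, h1⟩
  obtain ⟨e, le, pe⟩ := hword [] (by decide)
  obtain ⟨a, la, pa⟩ := hword [1] (by decide)
  obtain ⟨b, lb, pb⟩ := hword [2] (by decide)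
  obtain ⟨ab, lab, pab⟩ := hword [1, 2] (by decide)
  obtain ⟨ba, lba, pba⟩ := hword [2, 1] (by decide)
  obtain ⟨aba, laba, paba⟩ := hword [1, 2, 1] (by decide)
  obtain ⟨abb, labb, pabb⟩ := hword [1, 2, 2] (by decide)
  obtain ⟨abab, labab, pabab⟩ := hword [1, 2, 1, 2] (by decide)
  obtain ⟨abba, labba, pabba⟩ := hword [1, 2, 2, 1] (by decide)
  clear hword
  simp only [List.length_cons, List.length_nil, zero_add, Nat.reduceAdd] at le la lb lab lba laba labb labab labba
  simp only [pos_one_cons, pos_two_cons, pos_nil, mul_zero, add_zero, mul_one]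
    at pe pa pb pab pba paba pabb pabab pabba
  -- This is the coincidence of `122` and `211`, from `ρ + ρ² = 1`.
  replace pabb : pos abb = 1 := by rw [pabb]; linear_combination gs
  replace pabba : pos abba = 1 := by rw [pabba]; linear_combination gs
  replace pabab : pos abab = 3 * rho - 1 := by rw [pabab]; linear_combination gc
  have T := fun w : W => hS.sel.subset w.2
  -- the limits of the slopes
  have ce := hS.tendsto_slope_root e le pe
  have ca := hS.tendsto_slope_one hx hy a e (k := 0) la le (by rw [pe, pa])
    (fun v hv hl => by rw [pa, pos_of_length_one hv hl]; norm_num) ce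
  have cb := hS.tendsto_slope_two hx hy b e (k := 0) lb le (by rw [pe, pb]; norm_num)
    (fun v hv hl => by rw [pb, pos_of_length_one hv hl]; norm_num) ce
  have cab := hS.tendsto_slope_two hx hy ab a (k := 1) lab la (by rw [pa, pab]; ring)
    (fun v hv hl heq => by
      rw [pab] at heq
      rcases pos_of_length_two hv hl with h | h <;> linarith) ca
  have cba := hS.tendsto_slope_one hx hy ba b (k := 1) lba lb (by rw [pb, pba])
    (fun v hv hl heq => by
      rw [pba] at heq
      rcases pos_of_length_two hv hl with h | h <;> linarith) cb
  have caba := hS.tendsto_slope_one hx hy aba ab (k := 2) laba lab (by rw [pab, paba])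
    (fun v hv hl heq => by
      rw [paba, gs] at heq
      rcases pos_of_length_three hv hl with h | h | h | h <;> linarith) cab
  -- The overlap cell is fed from both sides, by `21` and by `12`.
  have cabb := hS.tendsto_slope_both hx hy abb ba ab (k := 2) labb lba (by rw [pba, pabb]) lab
    (by rw [pab, pabb]; linear_combination gs) cba cab
  have cabab := hS.tendsto_slope_two hx hy abab aba (k := 3) labab laba
    (by rw [paba, pabab]; linear_combination gc)
    (fun v hv hl heq => by
      rw [pabab] at heq
      rcases pos_of_length_four hv hl with h | h | h | h <;> linarith) caba
  have cabba := hS.tendsto_slope_one hx hy abba abb (k := 3) labba labb (by rw [pabb, pabba])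
    (fun v hv hl heq => by
      rw [pabba, gc] at heq
      rcases pos_of_length_four hv hl with h | h | h | h <;> linarith) cabb
  -- consistency of the increments
  have v0 : ∀ (w : W) (k : ℕ) (t : ℝ) n, (w : List (Fin 3)).length = k + 1 → pos w = t →
      pullback w (h n) 0 = h n (pt k t) := fun w k t n hl hp => by
    rw [pullback_top_zero (T w) hl, hp]
  have v1 : ∀ (w : W) (k : ℕ) (t : ℝ) n, (w : List (Fin 3)).length = k + 1 → pos w = t →
      pullback w (h n) 1 = h n (pt (k + 1) t) := fun w k t n hl hp => by
    rw [pullback_top_one (T w) hl, hp]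
  have v2 : ∀ (w : W) (k : ℕ) (t : ℝ) n, (w : List (Fin 3)).length = k + 1 →
      pos w + rho ^ k = t → pullback w (h n) 2 = h n (pt (k + 1) t) := fun w k t n hl hp => by
    rw [pullback_top_two (T w) hl, hp]
  -- Both sides telescope from `q 0` down to `pt 3 1`.
  have hA1 := tendsto_nhds_unique_of_eventuallyEq
    (((hS.tendsto_inc e ce).1.add (hS.tendsto_inc a ca).2).add (hS.tendsto_inc ab cab).2)
    (((hS.tendsto_inc e ce).2.add (hS.tendsto_inc b cb).1).add (hS.tendsto_inc ba cba).1)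
    (Eventually.of_forall fun n => by
      beta_reduce
      rw [v0 e 0 0 n le pe, v1 e 0 0 n le pe, v2 e 0 1 n le (by rw [pe]; norm_num),
        v0 a 1 0 n la pa, v2 a 1 rho n la (by rw [pa]; ring),
        v0 ab 2 rho n lab pab, v2 ab 2 1 n lab (by rw [pab]; linear_combination gs),
        v0 b 1 1 n lb pb, v1 b 1 1 n lb pb, v0 ba 2 1 n lba pba, v1 ba 2 1 n lba pba]
      ring)
  -- Both sides telescope from the top of `12`, which is `pt 2 rho`, down to `pt 5 1`.
  have hB1 := tendsto_nhds_unique_of_eventuallyEq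
    (((hS.tendsto_inc ab cab).1.add (hS.tendsto_inc aba caba).2).add
      (hS.tendsto_inc abab cabab).2)
    (((hS.tendsto_inc ab cab).2.add (hS.tendsto_inc abb cabb).1).add
      (hS.tendsto_inc abba cabba).1)
    (Eventually.of_forall fun n => by
      beta_reduce
      rw [v0 ab 2 rho n lab pab, v1 ab 2 rho n lab pab,
        v2 ab 2 1 n lab (by rw [pab]; linear_combination gs),
        v0 aba 3 rho n laba paba,
        v2 aba 3 (3 * rho - 1) n laba (by rw [paba]; linear_combination gc),
        v0 abab 4 _ n labab pabab,
        v2 abab 4 1 n labab (by rw [pabab]; linear_combination rho * gc + 2 * gs),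
        v0 abb 3 1 n labb pabb, v1 abb 3 1 n labb pabb,
        v0 abba 4 1 n labba pabba, v1 abba 4 1 n labba pabba]
      ring)
  exact inconsistent_increments hr hr1 hlam hA hS.B_nonneg hS.inc_add hx hy hA1 hB1

end Setup


/-! ### Quadratic forms on three points -/

/-- `D` is the form with (possibly negative) conductances `a, b, c` on the edges `01, 02, 12`. -/
def HasCoeffs (a b c : ℝ) (D : LinearMap.BilinForm ℝ (Fin 3 → ℝ)) : Prop :=
  ∀ u v, D u v = a * (u 0 - u 1) * (v 0 - v 1) + b * (u 0 - u 2) * (v 0 - v 2)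
    + c * (u 1 - u 2) * (v 1 - v 2)

lemma IsConductance.hasCoeffs {a : Matrix (Fin 3) (Fin 3) ℝ} (ha : IsConductance a) :
    HasCoeffs (a 0 1) (a 0 2) (a 1 2) (conductanceForm a) := by
  intro u v
  have h1 : a 1 0 = a 0 1 := ha.symm.apply 0 1
  have h2 : a 2 0 = a 0 2 := ha.symm.apply 0 2
  have h3 : a 2 1 = a 1 2 := ha.symm.apply 1 2
  simp only [conductanceForm, LinearMap.mk₂_apply, Fin.sum_univ_three, h1, h2, h3, ha.diag]
  ring

/-- Nonnegative conductances on a connected graph with vertices `0, 1, 2`. -/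
structure IsNetwork (a b c : ℝ) : Prop where
  a_nonneg : 0 ≤ a
  b_nonneg : 0 ≤ b
  c_nonneg : 0 ≤ c
  row_zero : 0 < a ∨ 0 < b
  row_one : 0 < a ∨ 0 < c
  row_two : 0 < b ∨ 0 < c

lemma IsConductance.isNetwork {a : Matrix (Fin 3) (Fin 3) ℝ} (ha : IsConductance a) :
    IsNetwork (a 0 1) (a 0 2) (a 1 2) := by
  have h1 : a 1 0 = a 0 1 := ha.symm.apply 0 1
  have h2 : a 2 0 = a 0 2 := ha.symm.apply 0 2
  have h3 : a 2 1 = a 1 2 := ha.symm.apply 1 2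
  have hrow := fun i => ha.irreducible.exists_pos i
  simp only [Fin.exists_fin_succ, Fin.succ_zero_eq_one, Fin.succ_one_eq_two,
    IsEmpty.exists_iff, or_false] at hrow
  have r0 := hrow 0
  have r1 := hrow 1
  have r2 := hrow 2
  rw [ha.diag] at r0 r1 r2
  rw [h1] at r1
  rw [h2, h3] at r2
  simp only [lt_irrefl, false_or, or_false] at r0 r1 r2
  exact ⟨ha.irreducible.nonneg _ _, ha.irreducible.nonneg _ _, ha.irreducible.nonneg _ _,
    r0, r1, r2⟩

section
variable {a b c : ℝ} {D : LinearMap.BilinForm ℝ (Fin 3 → ℝ)}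

lemma HasCoeffs.apply_self (hD : HasCoeffs a b c D) (u : Fin 3 → ℝ) :
    D u u = a * (u 0 - u 1) ^ 2 + b * (u 0 - u 2) ^ 2 + c * (u 1 - u 2) ^ 2 := by
  rw [hD]; ring

lemma HasCoeffs.nonneg (hD : HasCoeffs a b c D) (hN : IsNetwork a b c) (u : Fin 3 → ℝ) :
    0 ≤ D u u := by
  have := hN.a_nonneg
  have := hN.b_nonneg
  have := hN.c_nonneg
  rw [hD.apply_self]; positivity

lemma HasCoeffs.pos (hD : HasCoeffs a b c D) (hN : IsNetwork a b c) {u : Fin 3 → ℝ}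
    (hu : ¬ (u 1 = u 0 ∧ u 2 = u 0)) : 0 < D u u := by
  refine (hD.nonneg hN u).lt_of_ne fun h0 => hu ?_
  rw [hD.apply_self] at h0
  have h1 := mul_nonneg hN.a_nonneg (sq_nonneg (u 0 - u 1))
  have h2 := mul_nonneg hN.b_nonneg (sq_nonneg (u 0 - u 2))
  have h3 := mul_nonneg hN.c_nonneg (sq_nonneg (u 1 - u 2))
  have key : ∀ {k x : ℝ}, 0 < k → k * x ^ 2 = 0 → x = 0 := fun hk hx =>
    pow_eq_zero_iff two_ne_zero |>.1 ((mul_eq_zero.1 hx).resolve_left hk.ne')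
  have k1 : a * (u 0 - u 1) ^ 2 = 0 := by linarith
  have k2 : b * (u 0 - u 2) ^ 2 = 0 := by linarith
  have k3 : c * (u 1 - u 2) ^ 2 = 0 := by linarith
  rcases hN.row_zero with ha | hb
  · have e1 := key ha k1
    rcases hN.row_two with hb | hc
    · have e2 := key hb k2
      constructor <;> linarith
    · have e2 := key hc k3
      constructor <;> linarith
  · have e1 := key hb k2
    rcases hN.row_one with ha | hc
    · have e2 := key ha k1
      constructor <;> linarith
    · have e2 := key hc k3
      constructor <;> linarith

lemma HasCoeffs.eq_smul {a' b' c' α : ℝ} {D' : LinearMap.BilinForm ℝ (Fin 3 → ℝ)}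
    (hD : HasCoeffs a b c D) (hD' : HasCoeffs a' b' c' D')
    (h : ∀ u, D' u u = α * D u u) : D' = α • D := by
  have e0 := h ![1, 0, 0]
  have e1 := h ![0, 1, 0]
  have e2 := h ![0, 0, 1]
  rw [hD.apply_self, hD'.apply_self] at e0 e1 e2
  simp at e0 e1 e2
  have ha : a' = α * a := by linarith
  have hb : b' = α * b := by linarith
  have hc : c' = α * c := by linarith
  refine LinearMap.ext₂ fun u v => ?_
  rw [LinearMap.smul_apply, LinearMap.smul_apply, hD, hD', ha, hb, hc, smul_eq_mul]
  ring

end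

/-- The ratio of two network energies attains its minimum. -/
lemma exists_min_ratio {a b c a' b' c' : ℝ} {D D' : LinearMap.BilinForm ℝ (Fin 3 → ℝ)}
    (hD : HasCoeffs a b c D) (hN : IsNetwork a b c) (hD' : HasCoeffs a' b' c' D') :
    ∃ f : Fin 3 → ℝ, ¬ (f 1 = f 0 ∧ f 2 = f 0) ∧
      ∀ u, D' f f / D f f * D u u ≤ D' u u := by
  -- The ratio ignores constants and scaling, so it lives on the unit circle of increments.
  set K : Set (ℝ × ℝ) := {z | z.1 ^ 2 + z.2 ^ 2 = 1} with hK
  have hKc : IsCompact K := by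
    refine (isCompact_Icc (a := ((-1 : ℝ), (-1 : ℝ))) (b := ((1 : ℝ), (1 : ℝ)))).of_isClosed_subset
      (isClosed_eq (by fun_prop) continuous_const) fun z hz => ?_
    have hz' : z.1 ^ 2 + z.2 ^ 2 = 1 := hz
    refine ⟨⟨?_, ?_⟩, ⟨?_, ?_⟩⟩ <;> simp only <;> nlinarith [sq_nonneg z.1, sq_nonneg z.2]
  have hne : K.Nonempty := ⟨(1, 0), by simp [hK]⟩
  set vec : ℝ × ℝ → Fin 3 → ℝ := fun z => ![0, z.1, z.2] with hvec
  have hvecne : ∀ z ∈ K, ¬ (vec z 1 = vec z 0 ∧ vec z 2 = vec z 0) := by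
    rintro z hz ⟨h1, h2⟩
    have hz' : z.1 ^ 2 + z.2 ^ 2 = 1 := hz
    have h1' : z.1 = 0 := h1
    have h2' : z.2 = 0 := h2
    rw [h1', h2'] at hz'
    norm_num at hz'
  have hform : ∀ {a b c : ℝ} {D : LinearMap.BilinForm ℝ (Fin 3 → ℝ)}, HasCoeffs a b c D →
      ∀ z, D (vec z) (vec z) = a * z.1 ^ 2 + b * z.2 ^ 2 + c * (z.1 - z.2) ^ 2 := by
    intro a b c D hD z
    rw [hD.apply_self]; simp [hvec]
  have hcont : ContinuousOn (fun z => D' (vec z) (vec z) / D (vec z) (vec z)) K := by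
    refine ContinuousOn.div ?_ ?_ fun z hz => (hD.pos hN (hvecne z hz)).ne'
    · simp only [hform hD']; fun_prop
    · simp only [hform hD]; fun_prop
  obtain ⟨z, hz, hmin⟩ := hKc.exists_isMinOn hne hcont
  refine ⟨vec z, hvecne z hz, fun u => ?_⟩
  by_cases hu : u 1 = u 0 ∧ u 2 = u 0
  · rw [hD.apply_self u, hD'.apply_self u, hu.1, hu.2]; simp
  set n := Real.sqrt ((u 1 - u 0) ^ 2 + (u 2 - u 0) ^ 2) with hn
  have hpos : 0 < (u 1 - u 0) ^ 2 + (u 2 - u 0) ^ 2 := by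
    refine (by positivity : (0 : ℝ) ≤ _).lt_of_ne fun h => hu ?_
    have h1 : (u 1 - u 0) ^ 2 = 0 := by nlinarith [sq_nonneg (u 1 - u 0), sq_nonneg (u 2 - u 0)]
    have h2 : (u 2 - u 0) ^ 2 = 0 := by nlinarith [sq_nonneg (u 1 - u 0), sq_nonneg (u 2 - u 0)]
    exact ⟨sub_eq_zero.1 (pow_eq_zero_iff two_ne_zero |>.1 h1),
      sub_eq_zero.1 (pow_eq_zero_iff two_ne_zero |>.1 h2)⟩
  have hn0 : n ≠ 0 := (Real.sqrt_pos.2 hpos).ne'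
  have hn2 : n ^ 2 = (u 1 - u 0) ^ 2 + (u 2 - u 0) ^ 2 := Real.sq_sqrt hpos.le
  set z' : ℝ × ℝ := ((u 1 - u 0) / n, (u 2 - u 0) / n) with hz'
  have hz'K : z' ∈ K := by
    change ((u 1 - u 0) / n) ^ 2 + ((u 2 - u 0) / n) ^ 2 = 1
    rw [div_pow, div_pow, ← add_div, ← hn2, div_self (pow_ne_zero 2 hn0)]
  have hscale : ∀ {a b c : ℝ} {D : LinearMap.BilinForm ℝ (Fin 3 → ℝ)}, HasCoeffs a b c D →
      D u u = n ^ 2 * D (vec z') (vec z') := by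
    intro a b c D hD
    rw [hform hD, hD.apply_self, hz']
    field_simp
    ring
  have hle : D' (vec z) (vec z) / D (vec z) (vec z) ≤ D' (vec z') (vec z') / D (vec z') (vec z') :=
    hmin hz'K
  rw [le_div_iff₀ (hD.pos hN (hvecne z' hz'K))] at hle
  rw [hscale hD, hscale hD']
  have := mul_le_mul_of_nonneg_left hle (sq_nonneg n)
  linarith

/-- A nonzero positive semidefinite form on three points which vanishes at `f` measures the
deviation from the multiples of `f`. -/
lemma exists_deviation_form {a b c : ℝ}
    (hQ : ∀ p s : ℝ, 0 ≤ a * p ^ 2 + b * s ^ 2 + c * (p - s) ^ 2)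
    (hne : ¬ (a = 0 ∧ b = 0 ∧ c = 0)) {p₀ s₀ : ℝ}
    (h0 : a * p₀ ^ 2 + b * s₀ ^ 2 + c * (p₀ - s₀) ^ 2 = 0) :
    ∃ T : ℝ, 0 < T ∧ ∀ p s : ℝ,
      (p₀ ^ 2 + s₀ ^ 2) * (a * p ^ 2 + b * s ^ 2 + c * (p - s) ^ 2) = T * (p * s₀ - s * p₀) ^ 2 := by
  have hg : ∀ {K g : ℝ}, (∀ t : ℝ, 0 ≤ K * (t * t) + g * t + 0) → g = 0 := fun h => by
    have := discrim_le_zero h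
    unfold discrim at this
    nlinarith
  -- The null vector minimizes the form, so the gradient vanishes there.
  have e1 : 2 * ((a + c) * p₀ - c * s₀) = 0 := hg (K := a + c) fun t => by
    have := hQ (p₀ + t) s₀
    linarith
  have e2 : 2 * ((b + c) * s₀ - c * p₀) = 0 := hg (K := b + c) fun t => by
    have := hQ p₀ (s₀ + t)
    linarith
  -- `T` is the trace of the form in the coordinates `p, s`; a semidefinite form of trace zero
  -- vanishes.
  refine ⟨(a + c) + (b + c), ?_, fun p s => ?_⟩
  · have q1 := hQ 1 0
    have q2 := hQ 0 1
    have q3 := hQ 1 1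
    have q4 := hQ 1 (-1)
    norm_num at q1 q2 q3 q4
    refine (by linarith : 0 ≤ (a + c) + (b + c)).lt_of_ne fun h => hne ?_
    refine ⟨?_, ?_, ?_⟩ <;> linarith
  · linear_combination
      (p ^ 2 * p₀ / 2 + p * s * s₀ - s ^ 2 * p₀ / 2) * e1 +
        (s ^ 2 * s₀ / 2 + p * s * p₀ - p ^ 2 * s₀ / 2) * e2

/-- If `D₁ ≥ α D₂` are solutions for the same eigenvalue with equality at `f` but not everywhere,
and one of them is symmetric, then `f` is antisymmetric. -/
lemma antisymmetric_of_touching {W : Set (List (Fin 3))} (hW : IsWordSelection W)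
    {r lam α a₁ b₁ c₁ a₂ b₂ c₂ A B : ℝ} (hr : 0 < r) (hr1 : r < 1) (hlam : 0 < lam) (hα : 0 < α)
    {D₁ D₂ D : LinearMap.BilinForm ℝ (Fin 3 → ℝ)} (hD₁ : HasCoeffs a₁ b₁ c₁ D₁)
    (hD₂ : HasCoeffs a₂ b₂ c₂ D₂) (hN₁ : IsNetwork a₁ b₁ c₁) (hN₂ : IsNetwork a₂ b₂ c₂)
    (hs₁ : SolvesRenorm W r lam D₁) (hs₂ : SolvesRenorm W r lam D₂)
    (hle : ∀ u, α * D₂ u u ≤ D₁ u u) {f : Fin 3 → ℝ} (hf : D₁ f f = α * D₂ f f)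
    (hne : D₁ ≠ α • D₂) (hD : D = D₁ ∨ D = D₂) (hDs : IsSymmForm A B D) (hA : 0 < A)
    (hB : 0 ≤ B) : (f 1 - f 0) + (f 2 - f 0) = 0 := by
  by_contra hσ
  set σ := (f 1 - f 0) + (f 2 - f 0) with hσdef
  set f' : Fin 3 → ℝ := σ⁻¹ • f with hf'def
  set p := f' 1 - f' 0 with hp
  set s := f' 2 - f' 0 with hs
  have hps : p + s = 1 := by
    have : p + s = σ⁻¹ * σ := by
      simp only [hp, hs, hf'def, hσdef, Pi.smul_apply, smul_eq_mul]; ring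
    rw [this, inv_mul_cancel₀ hσ]
  have hf' : D₁ f' f' = α * D₂ f' f' := by
    simp only [hf'def, map_smul, LinearMap.smul_apply, smul_eq_mul, hf]; ring
  obtain ⟨h, hm₁, hm₂, hnull⟩ := exists_common_minimizing hs₁ hs₂ hr (hD₁.nonneg hN₁)
    (hD₂.nonneg hN₂) hlam hα hle hf'
  have hdiff : ∀ u, D₁ u u - α * D₂ u u = (a₁ - α * a₂) * (u 1 - u 0) ^ 2 +
      (b₁ - α * b₂) * (u 2 - u 0) ^ 2 +
      (c₁ - α * c₂) * ((u 1 - u 0) - (u 2 - u 0)) ^ 2 := fun u => by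
    rw [hD₁.apply_self, hD₂.apply_self]; ring
  obtain ⟨T, hT, hTeq⟩ := exists_deviation_form (a := a₁ - α * a₂) (b := b₁ - α * b₂)
    (c := c₁ - α * c₂) (fun p s => by
      have := sub_nonneg.2 (hle ![0, p, s])
      rw [hdiff] at this
      simpa using this)
    (fun ⟨e1, e2, e3⟩ => hne (hD₂.eq_smul hD₁ fun u => by
      have := hdiff u
      rw [e1, e2, e3] at this
      linarith))
    (p₀ := p) (s₀ := s) (by rw [← hdiff f', hf', sub_self])
  have hdev : ∀ w : W, Tendsto (fun n => deviation p s w (h n)) atTop (𝓝 0) := fun w => by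
    have h1 := (hnull w).const_mul ((p ^ 2 + s ^ 2) / T)
    rw [mul_zero] at h1
    have h2 : Tendsto (fun n => deviation p s w (h n) ^ 2) atTop (𝓝 0) := h1.congr fun n => by
      rw [hdiff, div_mul_eq_mul_div, hTeq, deviation]
      field_simp
    refine (tendsto_zero_iff_abs_tendsto_zero _).2 ?_
    have := h2.sqrt
    simpa [Real.sqrt_sq_eq_abs, Function.comp_def] using this
  -- The sequence is minimizing for both forms, so it does not matter which of them is symmetric.
  rcases hD with rfl | rfl
  · exact Setup.contradiction ⟨hW, hr, hlam, hA, hB, hDs, hs₁, hm₁, rfl, rfl, hps, hdev⟩ hr1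
  · exact Setup.contradiction ⟨hW, hr, hlam, hA, hB, hDs, hs₂, hm₂, rfl, rfl, hps, hdev⟩ hr1

/-- Two solutions, one of them symmetric, are proportional. -/
lemma proportional_of_solves {W : Set (List (Fin 3))} (hW : IsWordSelection W)
    {r lam lam' A B a b c : ℝ} (hr : 0 < r) (hr1 : r < 1) (hlam : 0 < lam) (hlam' : 0 < lam')
    {D D' : LinearMap.BilinForm ℝ (Fin 3 → ℝ)} (hD : HasCoeffs A A B D)
    (hD' : HasCoeffs a b c D') (hN : IsNetwork A A B) (hN' : IsNetwork a b c)
    (hs : SolvesRenorm W r lam D) (hs' : SolvesRenorm W r lam' D') :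
    ∃ k : ℝ, 0 < k ∧ D' = k • D := by
  have hA : 0 < A := by rcases hN.row_zero with h | h <;> exact h
  obtain ⟨f, hf, hfmin⟩ := exists_min_ratio hD hN hD'
  obtain ⟨g, hg, hgmin⟩ := exists_min_ratio hD' hN' hD
  have hDf := hD.pos hN hf
  have hD'f := hD'.pos hN' hf
  have hDg := hD.pos hN hg
  have hD'g := hD'.pos hN' hg
  set α := D' f f / D f f with hα
  set β := D g g / D' g g with hβ
  have hαpos : 0 < α := div_pos hD'f hDf
  have hβpos : 0 < β := div_pos hDg hD'g
  have hfα : D' f f = α * D f f := by rw [hα]; field_simp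
  have hgβ : D g g = β * D' g g := by rw [hβ]; field_simp
  have hle := hs'.eigenvalue_le hs hr (hD'.nonneg hN') (hD.nonneg hN) hlam' hαpos hfmin hfα hD'f
  have hge := hs.eigenvalue_le hs' hr (hD.nonneg hN) (hD'.nonneg hN') hlam hβpos hgmin hgβ hDg
  obtain rfl : lam = lam' := le_antisymm hle hge
  by_cases h1 : D' = α • D
  · exact ⟨α, hαpos, h1⟩
  by_cases h2 : D = β • D'
  · exact ⟨β⁻¹, inv_pos.2 hβpos, by rw [h2, smul_smul, inv_mul_cancel₀ hβpos.ne', one_smul]⟩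
  have hDs : IsSymmForm A B D := hD
  have zf := antisymmetric_of_touching hW hr hr1 hlam hαpos hD' hD hN' hN hs' hs hfmin hfα h1
    (Or.inr rfl) hDs hA hN.c_nonneg
  have zg := antisymmetric_of_touching hW hr hr1 hlam hβpos hD hD' hN hN' hs hs' hgmin hgβ h2
    (Or.inl rfl) hDs hA hN.c_nonneg
  refine ⟨α, hαpos, hD.eq_smul hD' fun u => ?_⟩
  -- On antisymmetric functions each form is a constant times one square, so `D' / D` takes the same
  -- value at `f` and at `g`.
  have hsq : ∀ {a b c : ℝ} {D : LinearMap.BilinForm ℝ (Fin 3 → ℝ)}, HasCoeffs a b c D →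
      ∀ u : Fin 3 → ℝ, (u 1 - u 0) + (u 2 - u 0) = 0 →
        D u u = (a + b + 4 * c) * (u 1 - u 0) ^ 2 := by
    intro a b c D hD u hu
    have : u 2 = u 0 - (u 1 - u 0) := by linarith
    rw [hD.apply_self, this]; ring
  have hprod : α * β = 1 := by
    have e1 := hsq hD f zf
    have e2 := hsq hD' f zf
    have e3 := hsq hD g zg
    have e4 := hsq hD' g zg
    have hcross : D' f f * D g g = D f f * D' g g := by rw [e1, e2, e3, e4]; ring
    rw [hα, hβ, div_mul_div_comm, hcross, div_self (mul_pos hDf hD'g).ne']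
  refine le_antisymm ?_ (hfmin u)
  have := mul_le_mul_of_nonneg_left (hgmin u) hαpos.le
  rwa [← mul_assoc, hprod, one_mul] at this

/-! ### Multiples of a solution -/

lemma Psi_smul (W : Set (List (Fin 3))) (r : ℝ) {k : ℝ} (hk : 0 < k)
    (D : LinearMap.BilinForm ℝ (Fin 3 → ℝ)) (f : Plane → ℝ) :
    Psi W r (k • D) f = ENNReal.ofReal k * Psi W r D f := by
  unfold Psi
  rw [← ENNReal.tsum_mul_left]
  refine tsum_congr fun w => ?_
  rw [← ENNReal.ofReal_mul hk.le, LinearMap.smul_apply, LinearMap.smul_apply, smul_eq_mul]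
  congr 1; ring

lemma SolvesRenorm.smul {W : Set (List (Fin 3))} {r lam k : ℝ} (hk : 0 < k)
    {D : LinearMap.BilinForm ℝ (Fin 3 → ℝ)} (hs : SolvesRenorm W r lam D) :
    SolvesRenorm W r lam (k • D) := by
  intro u
  have h0 : ENNReal.ofReal k ≠ 0 := (ENNReal.ofReal_pos.2 hk).ne'
  have hdom : DomPsi W r (k • D) = DomPsi W r D := by
    ext f
    refine and_congr_right fun _ => ?_
    rw [Psi_smul W r hk, lt_top_iff_ne_top, lt_top_iff_ne_top, ne_eq, ne_eq, ENNReal.mul_eq_top]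
    simp [h0]
  have : renorm W r (k • D) u = ENNReal.ofReal k * renorm W r D u := by
    unfold renorm
    simp only [hdom, Psi_smul W r hk, ENNReal.mul_iInf_of_ne h0 ENNReal.ofReal_ne_top]
  rw [this, hs u, ← ENNReal.ofReal_mul hk.le, LinearMap.smul_apply, LinearMap.smul_apply,
    smul_eq_mul]
  congr 1; ring

end GoldenGasket
end

theorem theorem5p7 (W : Set (List (Fin 3))) (hW : GoldenGasket.IsWordSelection W)
    (r : ℝ) (hr0 : GoldenGasket.rho < r) (hr1 : r < 1)
    (D : LinearMap.BilinForm ℝ (Fin 3 → ℝ)) (hD : D ∈ GoldenGasket.MS)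
    (lam : ℝ) (hlam : 0 < lam) (hsol : GoldenGasket.SolvesRenorm W r lam D) :
    ∀ D' ∈ GoldenGasket.M,
      (∃ lam' : ℝ, 0 < lam' ∧ GoldenGasket.SolvesRenorm W r lam' D') ↔
        ∃ c : ℝ, 0 < c ∧ D' = c • D := by
  rintro D' ⟨a', ha', rfl⟩
  obtain ⟨a, ha, hsymm, rfl⟩ := hD
  constructor
  · rintro ⟨lam', hlam', hsol'⟩
    have hC := ha.hasCoeffs
    have hN := ha.isNetwork
    rw [← hsymm] at hC hN
    exact GoldenGasket.proportional_of_solves hW (GoldenGasket.rho_pos.trans hr0) hr1 hlam hlam'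
      hC ha'.hasCoeffs hN ha'.isNetwork hsol hsol'
  · rintro ⟨k, hk, hDk⟩
    exact ⟨lam, hlam, hDk ▸ hsol.smul hk⟩
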